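/- An inversion sequence of length $n$ is an integer sequence $e=e_1e_2\cdots e_n$ with $0\le e_i<i$ for all $1\le i\le n$. Let $\mathbf{I}_n(\underline{12}0)$ be the set of inversion sequences $e$ of length $n$ that avoid the vincular pattern $\underline{12}0$, i.e. for which there are no indices $2\le i<j\le n$ with $e_j<e_{i-1}<e_i$. Let $\mathbf{I}_n(110)$ be the set of inversion sequences $e$ of length $n$ that avoid the classical pattern $110$, i.e. for which there are no indices $1\le i<j<k\le n$ with $e_k<e_i=e_j$. For an inversion sequence $e$ of length $n\ge 1$, let $\mathrm{last}(e)=e_n$, let $\mathrm{zero}(e)$ be the number of indices $i$ with $e_i=0$, and let $\mathrm{rmin}(e)$ be the number of right-to-left minima of $e$, i.e. of indices $i$ such that $e_i<e_j$ for all $j$ with $i<j\le n$. **Proposition.** For every $n\ge 1$ the triple $(\mathrm{last},\mathrm{zero},\mathrm{rmin})$ has the same joint distribution over $\mathbf{I}_n(\underline{12}0)$ and over $\mathbf{I}_n(110)$; that is, for all integers $a,b,c\ge 0$, $$\bigl|\{e\in\mathbf{I}_n(\underline{12}0): \mathrm{last}(e)=a,\ \mathrm{zero}(e)=b,\ \mathrm{rmin}(e)=c\}\bigr|=\bigl|\{e\in\mathbf{I}_n(110):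 \mathrm{last}(e)=a,\ \mathrm{zero}(e)=b,\ \mathrm{rmin}(e)=c\}\bigr|.$$ -/

import Mathlib

namespace InvSeq

/-- A vincular pattern of length `k`: a word `letters` together with the set `glued` of those
positions `a` for which the letters at positions `a` and `a + 1` are joined by an underline.
A classical pattern has `glued = ∅`. Positions are numbered from `0`. -/
structure VincularPattern (k : ℕ) where
  letters : Fin k → ℕ
  glued : Finset (Fin k)

/-- The word `w` contains the vincular pattern `p`: there are positions `f 0 < f 1 < ⋯` of `w`
whose letters are order isomorphic to those of `p` (equal letters correspond to equal letters),
with adjacent positions wherever `p` has an underline. -/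
def Contains {n k : ℕ} (w : Fin n → ℕ) (p : VincularPattern k) : Prop :=
  ∃ f : Fin k → Fin n, StrictMono f ∧
    (∀ a b : Fin k, w (f a) < w (f b) ↔ p.letters a < p.letters b) ∧
    ∀ a b : Fin k, a ∈ p.glued → (b : ℕ) = a + 1 → (f b : ℕ) = f a + 1

/-- The pattern 120 in which the first two letters are underlined. -/
def pattern120 : VincularPattern 3 := ⟨![1, 2, 0], {0}⟩

/-- The classical pattern 110. -/
def pattern110 : VincularPattern 3 := ⟨![1, 1, 0], ∅⟩

/-- The inversion sequences of length `n`, with positions numbered from `0`: the word `e` is one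
iff `e i < i + 1` for all `i`. -/
def inversionSequences (n : ℕ) : Finset (Fin n → ℕ) :=
  Fintype.piFinset fun i => Finset.range ((i : ℕ) + 1)

open Classical in
/-- The inversion sequences of length `n` that avoid `p`. -/
noncomputable def avoiding (n : ℕ) {k : ℕ} (p : VincularPattern k) : Finset (Fin n → ℕ) :=
  (inversionSequences n).filter fun e => ¬ Contains e p

/-- The last entry of a non-empty word. -/
def last {n : ℕ} (hn : 1 ≤ n) (e : Fin n → ℕ) : ℕ :=
  e ⟨n - 1, Nat.sub_lt hn Nat.one_pos⟩

/-- The number of zero entries. -/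
def zero {n : ℕ} (e : Fin n → ℕ) : ℕ :=
  (Finset.univ.filter fun i : Fin n => e i = 0).card

/-- The number of right-to-left minima: entries strictly smaller than every later entry. -/
def rmin {n : ℕ} (e : Fin n → ℕ) : ℕ :=
  (Finset.univ.filter fun i : Fin n => ∀ j : Fin n, i < j → e i < e j).card

end InvSeq

namespace InvSeq

open Finset

/-! Fix a weight `w` of the last letter and of `rmin`, and let `A n k w` be the total weight of the
avoiding words of length `n` with `k` zeros. For both patterns, `A (n+1) (k+1) w` equals `A n k
(raise w) + k * A n (k+1) (raise w)` plus the sum over `i` of `A n (k+1+i) (lift w) + k * A n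
(k+2+i) (lift w)`. Letting `w` vary is what allows the recurrence to modify it; indicator weights
recover the joint distribution.

For 110, delete the initial zero and lower all positive letters. The word is recovered from the
result and the set `O` of those zeros that used to be ones. Avoidance at this level says that no
zero follows two ones, that is, `O` is in `almostUpper`. Counting such sets by the size of their
complement and by whether they contain the last zero gives the recurrence
(`sum_avoiding_pattern110_succ`, `sum_almostUpper_max`, `weightSum_pattern110_succ`).

For 120, a letter may be appended iff it is at least the largest ascent bottom `M` and at most the
length. As long as a zero is still to come, `M = 0`, so the positive runs before the last zero
decrease weakly; the prefixes of length `p` ending in the `k+1`-st zero are counted by the Stirling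
number `S(p-1, k)`. Cutting at the last zero gives `zeroSum`. Lowering the positive tail by one
gives a positive tail if it contained no one, and a tail with a zero otherwise
(`positiveExtensions_raise`). Identities for Stirling numbers turn this into the same recurrence
(`zeroSum_succ`). -/

/-! ### Weights and the generating tree for 120 -/

/-- The effect on a weight of raising all positive entries by one. -/
def raise (w : ℕ → ℕ → ℕ) : ℕ → ℕ → ℕ := fun a c => w (if a = 0 then 0 else a + 1) c

/-- The effect on a weight of raising all entries by one and prepending a zero. -/
def lift (w : ℕ → ℕ → ℕ) : ℕ → ℕ → ℕ := fun a c => w (a + 1) (c + 1)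

/-- The weight that sees a word through its part above a right-to-left minimum `d`. -/
def shift (d : ℕ) (w : ℕ → ℕ → ℕ) : ℕ → ℕ → ℕ := fun a c => w (a + d) (c + 1)

/-- The total weight of all extensions by `m` letters of a word avoiding `pattern120`. The letters
are counted from the largest ascent bottom `M` (or `0`) of the word, `h` is the length of the word
minus `M`, `d` is its last letter minus `M`, and `z` counts its zeros. The weight `W` receives the
number of zeros, the last letter and the number of right-to-left minima that are at least `M`. -/
def extensions : ℕ → ℕ → ℕ → ℕ → (ℕ → ℕ → ℕ → ℕ) → ℕ
  | 0, _, d, z, W => W z d (if d = 0 then 1 else 2)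
  | m + 1, h, 0, z, W =>
      extensions m (h + 1) 0 (z + 1) W + ∑ y ∈ range h, extensions m (h + 1) (y + 1) z W
  | m + 1, h, d + 1, z, W =>
      extensions m (h + 1) 0 (z + 1) W +
        ∑ y ∈ range (d + 1), extensions m (h + 1) (y + 1) z W +
        ∑ y ∈ range (h - d - 1), extensions m (h - d) (y + 1) 0 fun _ => shift (d + 1) (W z)

/-- The part of `extensions` in which no further zero is appended. -/
def positiveExtensions : ℕ → ℕ → ℕ → (ℕ → ℕ → ℕ) → ℕ
  | 0, _, d, w => w d (if d = 0 then 1 else 2)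
  | m + 1, h, 0, w => ∑ y ∈ range h, positiveExtensions m (h + 1) (y + 1) w
  | m + 1, h, d + 1, w =>
      ∑ y ∈ range (d + 1), positiveExtensions m (h + 1) (y + 1) w +
        ∑ y ∈ range (h - d - 1), extensions m (h - d) (y + 1) 0 fun _ => shift (d + 1) w

/-! ### Splitting an extension at its first new zero -/

/-- Sorts the weakly decreasing words of `i + 1` letters in `1, …, d` by their first letter `y + 1`.
-/
theorem sum_range_multichoose_succ (d i : ℕ) :
    ∑ y ∈ range d, Nat.multichoose (y + 1) i = Nat.multichoose d (i + 1) := by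
  induction d with
  | zero => simp
  | succ d ih => rw [sum_range_succ, ih, Nat.multichoose_succ_succ]

theorem extensions_const (m h d z z' : ℕ) (w : ℕ → ℕ → ℕ) :
    extensions m h d z (fun _ => w) = extensions m h d z' fun _ => w := by
  induction m generalizing h d z z' with
  | zero => simp [extensions]
  | succ m ih =>
    cases d with
    | zero =>
      simp only [extensions]
      rw [ih _ _ (z + 1) (z' + 1)]
      congr 1
      exact sum_congr rfl fun y _ => ih _ _ _ _
    | succ d =>
      simp only [extensions]
      rw [ih _ _ (z + 1) (z' + 1)]
      congr 2
      exact sum_congr rfl fun y _ => ih _ _ _ _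

theorem sum_extensions_first_zero {m : ℕ} (h n z : ℕ) (W : ℕ → ℕ → ℕ → ℕ)
    (ih : ∀ y, extensions m (h + 1) (y + 1) z W = positiveExtensions m (h + 1) (y + 1) (W z) +
      ∑ i ∈ range m, Nat.multichoose (y + 1) i *
        extensions (m - 1 - i) (h + 1 + i + 1) 0 (z + 1) W) :
    extensions m (h + 1) 0 (z + 1) W + ∑ y ∈ range n, extensions m (h + 1) (y + 1) z W =
      ∑ y ∈ range n, positiveExtensions m (h + 1) (y + 1) (W z) +
        ∑ i ∈ range (m + 1), Nat.multichoose n i *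
          extensions (m + 1 - 1 - i) (h + i + 1) 0 (z + 1) W := by
  -- The peeled-off term `i = 0` is the zero appended at once; in the others a first positive letter
  -- `y + 1` is absorbed into the block.
  rw [sum_congr rfl fun y _ => ih y, sum_add_distrib, sum_comm, sum_range_succ']
  simp only [← sum_mul, sum_range_multichoose_succ, Nat.multichoose_zero_right]
  have : ∀ i ∈ range m, Nat.multichoose n (i + 1) *
      extensions (m - 1 - i) (h + 1 + i + 1) 0 (z + 1) W = Nat.multichoose n (i + 1) *
      extensions (m + 1 - 1 - (i + 1)) (h + (i + 1) + 1) 0 (z + 1) W := by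
    intro i _
    congr 2 <;> omega
  rw [sum_congr rfl this]
  simp
  ring

/-- An ascent from a positive letter excludes all later zeros. So the `i` positive letters before
the next zero form a weakly decreasing word bounded by the current letter. -/
theorem extensions_eq_first_zero (m h d z : ℕ) (W : ℕ → ℕ → ℕ → ℕ) :
    extensions m h (d + 1) z W = positiveExtensions m h (d + 1) (W z) +
      ∑ i ∈ range m, Nat.multichoose (d + 1) i *
        extensions (m - 1 - i) (h + i + 1) 0 (z + 1) W := by
  induction m generalizing h d z with
  | zero => simp [extensions, positiveExtensions]
  | succ m ih =>
    simp only [extensions, positiveExtensions]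
    rw [sum_extensions_first_zero h (d + 1) z W fun y => ih _ _ _]
    ring

theorem extensions_zero_eq_first_zero (m h z : ℕ) (W : ℕ → ℕ → ℕ → ℕ) :
    extensions m h 0 z W = positiveExtensions m h 0 (W z) +
      ∑ i ∈ range m, Nat.multichoose h i *
        extensions (m - 1 - i) (h + i + 1) 0 (z + 1) W := by
  cases m with
  | zero => simp [extensions, positiveExtensions]
  | succ m =>
    simp only [extensions, positiveExtensions]
    rw [sum_extensions_first_zero h h z W fun y => extensions_eq_first_zero _ _ _ _ _]

/-! ### Lowering a positive tail by one -/

theorem shift_one (w : ℕ → ℕ → ℕ) : shift 1 w = lift w := rfl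

theorem shift_raise (d : ℕ) (w : ℕ → ℕ → ℕ) :
    shift (d + 1) (raise w) = shift (d + 2) w := by
  funext a c
  simp [shift, raise, add_assoc]

/-- After a letter 1, lowering the tail makes this letter a zero, and further ones become further
zeros. `lift` restores the letter and the right-to-left minimum lost with the zero level. -/
theorem positiveExtensions_one (m h : ℕ) (w : ℕ → ℕ → ℕ) :
    positiveExtensions m (h + 1) 1 w = extensions m h 0 0 fun _ => lift w := by
  induction m generalizing h with
  | zero => simp [extensions, positiveExtensions, lift]
  | succ m ih =>
    simp only [extensions, positiveExtensions]
    simp [ih, shift_one, extensions_const m (h + 1) 0 1 0]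

/-- The same dichotomy as in `positiveExtensions_raise`, from a positive current letter. -/
theorem positiveExtensions_raise_succ (m h d : ℕ) (w : ℕ → ℕ → ℕ) :
    positiveExtensions m (h + 1) (d + 2) w + positiveExtensions m h (d + 1) (lift w) =
      positiveExtensions m h (d + 1) (raise w) + extensions m h (d + 1) 0 fun _ => lift w := by
  induction m generalizing h d with
  | zero => simp [extensions, positiveExtensions, lift, raise]
  | succ m ih =>
    have key : ∑ y ∈ range (d + 1), positiveExtensions m (h + 2) (y + 2) w +
        ∑ y ∈ range (d + 1), positiveExtensions m (h + 1) (y + 1) (lift w) =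
        ∑ y ∈ range (d + 1), positiveExtensions m (h + 1) (y + 1) (raise w) +
        ∑ y ∈ range (d + 1), extensions m (h + 1) (y + 1) 0 fun _ => lift w := by
      rw [← sum_add_distrib, ← sum_add_distrib]
      exact sum_congr rfl fun y _ => ih (h + 1) y
    have e1 : h + 1 - (d + 1) = h - d := by omega
    simp only [extensions, positiveExtensions]
    -- The term `y = 0` appends the letter 1, and from there `positiveExtensions_one` applies.
    rw [sum_range_succ' _ (d + 1), shift_raise, e1, positiveExtensions_one,
      extensions_const m (h + 1) 0 (0 + 1) 0]
    simp only [add_assoc, Nat.reduceAdd] at key ⊢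
    omega

/-- Lower a positive tail. Without ones it stays positive and is weighted by `raise`, which fixes 0
because the tail may be empty. With ones it becomes an extension having a new zero, weighted by
`lift`; these are all extensions minus the positive ones, and the subtracted term stands on the
left. -/
theorem positiveExtensions_raise (m h : ℕ) (w : ℕ → ℕ → ℕ) :
    positiveExtensions m (h + 1) 0 w + positiveExtensions m h 0 (lift w) =
      positiveExtensions m h 0 (raise w) + extensions m h 0 0 fun _ => lift w := by
  cases m with
  | zero => simp [extensions, positiveExtensions, lift, raise]
  | succ m =>
    have key : ∑ y ∈ range h, positiveExtensions m (h + 2) (y + 2) w +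
        ∑ y ∈ range h, positiveExtensions m (h + 1) (y + 1) (lift w) =
        ∑ y ∈ range h, positiveExtensions m (h + 1) (y + 1) (raise w) +
        ∑ y ∈ range h, extensions m (h + 1) (y + 1) 0 fun _ => lift w := by
      rw [← sum_add_distrib, ← sum_add_distrib]
      exact sum_congr rfl fun y _ => positiveExtensions_raise_succ m (h + 1) y w
    simp only [extensions, positiveExtensions]
    rw [sum_range_succ' _ h, positiveExtensions_one, extensions_const m (h + 1) 0 (0 + 1) 0]
    simp only [add_assoc, Nat.reduceAdd] at key ⊢
    omega

/-! ### Prefixes ending in a zero and Stirling numbers -/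

/-- One block step: `blockStep f p` is the weighted number of ways to reach a word of length `p`
ending in `0` from words of length `s < p` ending in `0`, counted with weight `f s`, by appending
a weakly decreasing positive block and a zero. -/
def blockStep (f : ℕ → ℕ) (p : ℕ) : ℕ :=
  ∑ s ∈ range p, f s * Nat.multichoose s (p - 1 - s)

/-- The number of words of length `p` ending in their `j + 1`-st zero whose positive runs are
weakly decreasing. -/
def prefixCount (j : ℕ) : ℕ → ℕ
  | 0 => 0
  | p + 1 => Nat.stirlingSecond p j

/-- Choose the `r` elements outside the block of a distinguished element and partition them into `k`
blocks. -/
theorem stirlingSecond_succ_succ_eq_sum (n k : ℕ) :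
    Nat.stirlingSecond (n + 1) (k + 1) =
      ∑ r ∈ range (n + 1), n.choose r * Nat.stirlingSecond r k := by
  induction n generalizing k with
  | zero => cases k <;> simp [Nat.stirlingSecond]
  | succ n ih =>
    have split : ∑ r ∈ range (n + 1 + 1), (n + 1).choose r * Nat.stirlingSecond r k =
        ∑ r ∈ range (n + 1), n.choose r * Nat.stirlingSecond r k +
          ∑ r ∈ range (n + 1), n.choose r * Nat.stirlingSecond (r + 1) k := by
      have h : ∑ r ∈ range (n + 1), n.choose r * Nat.stirlingSecond r k =
          ∑ r ∈ range (n + 1 + 1), n.choose r * Nat.stirlingSecond r k := by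
        rw [sum_range_succ _ (n + 1)]
        simp
      rw [h, sum_range_succ' _ (n + 1), sum_range_succ' _ (n + 1)]
      simp only [Nat.choose_succ_succ', add_mul, sum_add_distrib, Nat.choose_zero_right]
      ring
    rw [split, ← ih k]
    cases k with
    | zero => simp [Nat.stirlingSecond_succ_succ]
    | succ k =>
      have h : ∑ r ∈ range (n + 1), n.choose r * Nat.stirlingSecond (r + 1) (k + 1) =
          (k + 1) * Nat.stirlingSecond (n + 1) (k + 1 + 1) + Nat.stirlingSecond (n + 1) (k + 1) := by
        rw [ih, ih, mul_sum, ← sum_add_distrib]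
        exact sum_congr rfl fun r _ => by rw [Nat.stirlingSecond_succ_succ]; ring
      rw [h, Nat.stirlingSecond_succ_succ (n + 1) (k + 1)]
      ring

/-- Here `multichoose s (p - 1 - s)` is the binomial coefficient of `p - 2` over `s - 1`, so this is
the preceding Stirling identity. -/
theorem blockStep_prefixCount (j : ℕ) : blockStep (prefixCount j) = prefixCount (j + 1) := by
  funext p
  match p with
  | 0 => simp [blockStep, prefixCount]
  | 1 => simp [blockStep, prefixCount]
  | n + 2 =>
    simp only [blockStep, prefixCount, stirlingSecond_succ_succ_eq_sum]
    rw [sum_range_succ']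
    simp only [zero_mul, add_zero]
    refine sum_congr rfl fun s hs => ?_
    have hs' : s ≤ n := by simpa [Nat.lt_succ_iff] using hs
    rw [Nat.multichoose_eq, mul_comm, show s + 1 + (n + 2 - 1 - (s + 1)) - 1 = n by omega,
      show n + 2 - 1 - (s + 1) = n - s by omega, Nat.choose_symm hs']

theorem blockStep_add_mul (f g : ℕ → ℕ) (c : ℕ) :
    (blockStep fun p => f p + c * g p) = fun p => blockStep f p + c * blockStep g p := by
  funext p
  simp only [blockStep, mul_sum, ← sum_add_distrib]
  exact sum_congr rfl fun s _ => by ring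

theorem stirlingSecond_succ_eq_prefixCount (j p : ℕ) :
    Nat.stirlingSecond p (j + 1) = prefixCount j p + (j + 1) * prefixCount (j + 1) p := by
  cases p with
  | zero => simp [prefixCount]
  | succ p => simp only [prefixCount, Nat.stirlingSecond_succ_succ]; ring

theorem blockStep_stirlingSecond (j : ℕ) :
    (blockStep fun p => Nat.stirlingSecond p j) =
      fun p => prefixCount j p + j * prefixCount (j + 1) p := by
  cases j with
  | zero =>
    funext p
    cases p with
    | zero => simp [blockStep, prefixCount]
    | succ p =>
      simp only [blockStep, prefixCount]
      rw [sum_range_succ']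
      cases p <;> simp
  | succ j =>
    simp only [stirlingSecond_succ_eq_prefixCount]
    rw [blockStep_add_mul, blockStep_prefixCount, blockStep_prefixCount]

theorem iterate_blockStep_prefixCount (j c i : ℕ) :
    blockStep^[i] (fun p => prefixCount j p + c * prefixCount (j + 1) p) =
      fun p => prefixCount (j + i) p + c * prefixCount (j + i + 1) p := by
  induction i with
  | zero => rfl
  | succ i ih =>
    rw [Function.iterate_succ_apply', ih, blockStep_add_mul, blockStep_prefixCount,
      blockStep_prefixCount]
    rfl

/-! ### The recurrence for words sorted by their last zero -/

theorem sum_mul_extensions (n z : ℕ) (f : ℕ → ℕ) (W : ℕ → ℕ → ℕ → ℕ) :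
    ∑ p ∈ range (n + 1), f p * extensions (n - p) p 0 z W =
      ∑ p ∈ range (n + 1), f p * positiveExtensions (n - p) p 0 (W z) +
        ∑ p ∈ range (n + 1), blockStep f p * extensions (n - p) p 0 (z + 1) W := by
  simp only [extensions_zero_eq_first_zero (n - _) _ z W, mul_add, sum_add_distrib]
  congr 1
  simp only [blockStep, mul_sum, sum_mul]
  rw [sum_sigma', sum_sigma']
  refine sum_bij' (fun x _ => ⟨x.1 + x.2 + 1, x.1⟩) (fun x _ => ⟨x.2, x.1 - 1 - x.2⟩)
    ?_ ?_ ?_ ?_ ?_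
  · rintro ⟨p, i⟩ h
    simp only [mem_sigma, mem_range] at h ⊢
    omega
  · rintro ⟨p, i⟩ h
    simp only [mem_sigma, mem_range] at h ⊢
    omega
  · rintro ⟨p, i⟩ h
    simp only [Sigma.mk.injEq, heq_eq_eq, true_and]
    omega
  · rintro ⟨p, i⟩ h
    simp only [mem_sigma, mem_range] at h
    simp only [Sigma.mk.injEq, heq_eq_eq, and_true]
    omega
  · rintro ⟨p, i⟩ h
    simp only
    rw [mul_assoc, show p + i + 1 - 1 - p = i by omega,
      show n - p - 1 - i = n - (p + i + 1) by omega]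

theorem sum_mul_extensions_iterate (n z j : ℕ) (f : ℕ → ℕ) (W : ℕ → ℕ → ℕ → ℕ) :
    ∑ p ∈ range (n + 1), f p * extensions (n - p) p 0 z W =
      ∑ i ∈ range j, ∑ p ∈ range (n + 1),
          blockStep^[i] f p * positiveExtensions (n - p) p 0 (W (z + i)) +
        ∑ p ∈ range (n + 1), blockStep^[j] f p * extensions (n - p) p 0 (z + j) W := by
  induction j with
  | zero => simp
  | succ j ih =>
    rw [ih, sum_range_succ _ j, sum_mul_extensions n (z + j), Function.iterate_succ_apply']
    ring_nf

theorem prefixCount_eq_zero {j p : ℕ} (h : p ≤ j) : prefixCount j p = 0 := by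
  cases p with
  | zero => rfl
  | succ p => exact Nat.stirlingSecond_eq_zero_of_lt h

theorem sum_prefixCount_mul_extensions (n z j c : ℕ) (W : ℕ → ℕ → ℕ → ℕ) :
    ∑ p ∈ range (n + 1), (prefixCount j p + c * prefixCount (j + 1) p) *
        extensions (n - p) p 0 z W =
      ∑ i ∈ range (n + 1), ∑ p ∈ range (n + 1),
        (prefixCount (j + i) p + c * prefixCount (j + i + 1) p) *
          positiveExtensions (n - p) p 0 (W (z + i)) := by
  -- After `n + 1` block steps no prefix of length at most `n` remains, so the remainder vanishes.
  rw [sum_mul_extensions_iterate n z (n + 1)]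
  simp only [iterate_blockStep_prefixCount]
  rw [add_eq_left]
  refine sum_eq_zero fun p hp => ?_
  rw [mem_range] at hp
  rw [prefixCount_eq_zero (by omega), prefixCount_eq_zero (by omega)]
  simp

/-- The total weight of the words of length `n` with `k` zeros that avoid `pattern120`, sorted by
the position of the last zero. -/
def zeroSum (n : ℕ) : ℕ → (ℕ → ℕ → ℕ) → ℕ
  | 0, _ => 0
  | k + 1, w => ∑ p ∈ range (n + 1), prefixCount k p * positiveExtensions (n - p) p 0 w

theorem extensions_one_eq_zeroSum (n k : ℕ) (w : ℕ → ℕ → ℕ) :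
    extensions n 1 0 1 (fun z a c => if z = k then w a c else 0) = zeroSum (n + 1) k w := by
  have h := sum_prefixCount_mul_extensions (n + 1) 1 0 0
    (fun z a c => if z = k then w a c else 0)
  have hl : ∑ p ∈ range (n + 1 + 1), (prefixCount 0 p + 0 * prefixCount (0 + 1) p) *
      extensions (n + 1 - p) p 0 1 (fun z a c => if z = k then w a c else 0) =
      extensions n 1 0 1 (fun z a c => if z = k then w a c else 0) := by
    -- `prefixCount 0` is the indicator of length 1, the one-letter word 0.
    rw [sum_eq_single 1]
    · simp [prefixCount]
    · intro p _ hp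
      match p with
      | 0 => simp [prefixCount]
      | 1 => exact absurd rfl hp
      | p + 2 => simp [prefixCount]
    · simp
  have hz : ∀ m h d, positiveExtensions m h d (fun _ _ => 0) = 0 := by
    have hz' : ∀ m h d z, extensions m h d z (fun _ _ _ => 0) = 0 := by
      intro m
      induction m with
      | zero => intros; rfl
      | succ m ih =>
        intro h d z
        have : ∀ d, shift d (fun _ _ => 0) = fun _ _ => 0 := fun d => rfl
        cases d <;> simp [extensions, ih, this]
    intro m
    induction m with
    | zero => intros; rfl
    | succ m ih =>
      intro h d
      have : ∀ d, shift d (fun _ _ => 0) = fun _ _ => 0 := fun d => rfl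
      cases d <;> simp [positiveExtensions, ih, hz', this]
  rw [hl] at h
  rw [h]
  cases k with
  | zero => simp [zeroSum, hz]
  | succ k =>
    have hi : ∀ i, i ≠ k → ∑ p ∈ range (n + 1 + 1),
        (prefixCount (0 + i) p + 0 * prefixCount (0 + i + 1) p) *
          positiveExtensions (n + 1 - p) p 0 (fun a c => if 1 + i = k + 1 then w a c else 0) =
          0 := by
      intro i hik
      simp [hz, show ¬ 1 + i = k + 1 by omega]
    by_cases hk : k ≤ n + 1
    · rw [sum_eq_single k (fun i _ hik => hi i hik) (fun hk' => by simp at hk'; omega)]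
      simp [zeroSum, add_comm 1 k]
    · rw [sum_eq_zero fun i hi' => hi i (by simp at hi'; omega)]
      symm
      exact sum_eq_zero fun p hp => by
        rw [prefixCount_eq_zero (by simp at hp; omega), zero_mul]

theorem sum_stirlingSecond_mul_positiveExtensions {n : ℕ} (hn : 1 ≤ n) (k : ℕ)
    (w : ℕ → ℕ → ℕ) :
    ∑ p ∈ range (n + 1), Nat.stirlingSecond p k * positiveExtensions (n - p) p 0 w =
      zeroSum n k w + k * zeroSum n (k + 1) w := by
  cases k with
  | zero =>
    -- For `k = 0` only `p = 0` has a nonzero Stirling number, and at height 0 no positive letter is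
    -- available for a tail of length at least 1.
    obtain ⟨n, rfl⟩ := Nat.exists_eq_add_of_le' hn
    rw [sum_range_succ']
    simp [zeroSum, positiveExtensions]
  | succ k =>
    simp only [zeroSum, mul_sum, ← sum_add_distrib, stirlingSecond_succ_eq_prefixCount]
    exact sum_congr rfl fun p _ => by ring

theorem sum_stirlingSecond_mul_extensions (n k : ℕ) (w : ℕ → ℕ → ℕ) :
    ∑ p ∈ range (n + 1), Nat.stirlingSecond p k * extensions (n - p) p 0 0 (fun _ => w) =
      ∑ p ∈ range (n + 1), Nat.stirlingSecond p k * positiveExtensions (n - p) p 0 w +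
        ∑ i ∈ range (n + 1), (zeroSum n (k + 1 + i) w + k * zeroSum n (k + 2 + i) w) := by
  rw [sum_mul_extensions n 0, blockStep_stirlingSecond, sum_prefixCount_mul_extensions]
  congr 1
  refine sum_congr rfl fun i _ => ?_
  rw [show k + 1 + i = k + i + 1 by ring, show k + 2 + i = k + i + 1 + 1 by ring]
  simp only [zeroSum, mul_sum, ← sum_add_distrib]
  exact sum_congr rfl fun p _ => by ring

/-- `positiveExtensions_raise` is summed against `S(p, k)`. The positive part of the extensions
weighted by `lift w` cancels, leaving those with at least one new zero. -/
theorem zeroSum_succ {n : ℕ} (hn : 1 ≤ n) (k : ℕ) (w : ℕ → ℕ → ℕ) :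
    zeroSum (n + 1) (k + 1) w =
      zeroSum n k (raise w) + k * zeroSum n (k + 1) (raise w) +
        ∑ i ∈ range (n + 1),
          (zeroSum n (k + 1 + i) (lift w) + k * zeroSum n (k + 2 + i) (lift w)) := by
  have h : zeroSum (n + 1) (k + 1) w +
      ∑ p ∈ range (n + 1), Nat.stirlingSecond p k * positiveExtensions (n - p) p 0 (lift w) =
      ∑ p ∈ range (n + 1), Nat.stirlingSecond p k * positiveExtensions (n - p) p 0 (raise w) +
      ∑ p ∈ range (n + 1),
        Nat.stirlingSecond p k * extensions (n - p) p 0 0 (fun _ => lift w) := by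
    simp only [zeroSum]
    rw [sum_range_succ']
    simp only [prefixCount, zero_mul, add_zero, ← sum_add_distrib, ← mul_add]
    refine sum_congr rfl fun p _ => ?_
    rw [show n + 1 - (p + 1) = n - p by omega, positiveExtensions_raise]
  rw [sum_stirlingSecond_mul_extensions n k (lift w),
    sum_stirlingSecond_mul_positiveExtensions hn k (raise w)] at h
  omega

/-! ### Words avoiding 110: choosing which zeros to raise -/

theorem contains_pattern110_iff {n : ℕ} (e : Fin n → ℕ) :
    Contains e pattern110 ↔ ∃ i j k, i < j ∧ j < k ∧ e i = e j ∧ e k < e j := by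
  constructor
  · rintro ⟨f, hf, h, -⟩
    have h01 := h 0 1
    have h10 := h 1 0
    have h21 := h 2 1
    simp [pattern110] at h01 h10 h21
    exact ⟨f 0, f 1, f 2, hf (by decide), hf (by decide), le_antisymm h10 h01, h21⟩
  · rintro ⟨i, j, k, hij, hjk, h1, h2⟩
    refine ⟨![i, j, k], ?_, ?_, ?_⟩
    · intro a b hab
      fin_cases a <;> fin_cases b <;> simp at hab ⊢ <;> first | assumption | exact hij.trans hjk
    · intro a b
      fin_cases a <;> fin_cases b <;> simp [pattern110] <;> omega
    · intro a b hab
      simp [pattern110] at hab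

theorem mem_avoiding_pattern110 {n : ℕ} {e : Fin n → ℕ} :
    e ∈ avoiding n pattern110 ↔
      (∀ i : Fin n, e i ≤ i) ∧ ∀ i j k, i < j → j < k → e i = e j → e j ≤ e k := by
  simp only [avoiding, inversionSequences, mem_filter, Fintype.mem_piFinset, mem_range,
    Nat.lt_succ_iff, contains_pattern110_iff]
  push Not
  rfl

/-- The positions of the zero entries. -/
def zeroSet {n : ℕ} (e : Fin n → ℕ) : Finset (Fin n) :=
  univ.filter fun i => e i = 0

theorem mem_zeroSet {n : ℕ} {e : Fin n → ℕ} {i : Fin n} : i ∈ zeroSet e ↔ e i = 0 := by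
  simp [zeroSet]

theorem card_zeroSet {n : ℕ} (e : Fin n → ℕ) : (zeroSet e).card = zero e := rfl

/-- The subsets of `Z` of which at most one element lies below an element of the complement. -/
def almostUpper {α : Type*} [LinearOrder α] (Z : Finset α) : Finset (Finset α) :=
  Z.powerset.filter fun O => ∀ i ∈ O, ∀ j ∈ O, ∀ k ∈ Z, i < j → j < k → k ∈ O

theorem mem_almostUpper {α : Type*} [LinearOrder α] {Z O : Finset α} :
    O ∈ almostUpper Z ↔ O ⊆ Z ∧ ∀ i ∈ O, ∀ j ∈ O, ∀ k ∈ Z, i < j → j < k → k ∈ O := by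
  simp [almostUpper]

/-- If the new maximum `x` is left out, two elements of the set would both lie below it, so at most
one is allowed; if `x` is included, it imposes nothing. -/
theorem almostUpper_insert {α : Type*} [LinearOrder α] {Z : Finset α} {x : α}
    (hx : ∀ y ∈ Z, y < x) :
    almostUpper (insert x Z) =
      insert ∅ (Z.image fun y => {y}) ∪ (almostUpper Z).image (insert x) := by
  have hxZ : x ∉ Z := fun h => lt_irrefl _ (hx x h)
  ext O
  simp only [mem_union, mem_insert, mem_image, mem_almostUpper]
  constructor
  · rintro ⟨hO, h⟩
    by_cases hxO : x ∈ O
    · refine Or.inr ⟨O.erase x, ⟨?_, ?_⟩, insert_erase hxO⟩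
      · intro y hy
        rw [mem_erase] at hy
        exact (mem_insert.1 (hO hy.2)).resolve_left hy.1
      · intro i hi j hj k hk hij hjk
        rw [mem_erase] at hi hj ⊢
        exact ⟨fun h => hxZ (h ▸ hk), h i hi.2 j hj.2 k (Or.inr hk) hij hjk⟩
    · left
      have hOZ : O ⊆ Z := (subset_insert_iff_of_notMem hxO).1 hO
      rcases O.eq_empty_or_nonempty with rfl | ⟨y, hy⟩
      · exact Or.inl rfl
      · refine Or.inr ⟨y, hOZ hy, ?_⟩
        symm
        refine eq_singleton_iff_unique_mem.2 ⟨hy, fun z hz => ?_⟩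
        by_contra hne
        rcases lt_or_gt_of_ne hne with hlt | hlt
        · exact hxO (h z hz y hy x (Or.inl rfl) hlt (hx y (hOZ hy)))
        · exact hxO (h y hy z hz x (Or.inl rfl) hlt (hx z (hOZ hz)))
  · rintro ((rfl | ⟨y, hy, rfl⟩) | ⟨O, ⟨hO, h⟩, rfl⟩)
    · simp
    · refine ⟨by simp [hy], ?_⟩
      intro i hi j hj k _ hij
      rw [mem_singleton] at hi hj
      exact absurd hij (by simp [hi, hj])
    · refine ⟨insert_subset_insert _ hO, ?_⟩
      intro i hi j hj k hk hij hjk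
      rw [mem_insert] at hi hj ⊢
      grind

theorem sum_almostUpper_insert {α : Type*} [LinearOrder α] {Z : Finset α} {x : α}
    (hx : ∀ y ∈ Z, y < x) (f : Finset α → ℕ) :
    ∑ O ∈ almostUpper (insert x Z), f O =
      f ∅ + ∑ y ∈ Z, f {y} + ∑ O ∈ almostUpper Z, f (insert x O) := by
  have hxZ : x ∉ Z := fun h => lt_irrefl _ (hx x h)
  have hxO : ∀ O ∈ almostUpper Z, x ∉ O := fun O hO h => hxZ ((mem_almostUpper.1 hO).1 h)
  rw [almostUpper_insert hx, sum_union, sum_insert, sum_image, sum_image]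
  · intro O hO O' hO' h
    rw [← erase_insert (hxO O hO), ← erase_insert (hxO O' hO')]
    exact congrArg (fun s => s.erase x) h
  · intro y _ y' _ h
    simpa using h
  · simp
  · rw [disjoint_left]
    intro O hO hO'
    obtain ⟨O', -, rfl⟩ := mem_image.1 hO'
    rcases mem_insert.1 hO with h | h
    · exact absurd h (by simp)
    · obtain ⟨y, hy, h⟩ := mem_image.1 h
      have : x ∈ ({y} : Finset α) := by rw [h]; exact mem_insert_self _ _
      rw [mem_singleton] at this
      exact hxZ (this ▸ hy)

theorem card_insert_sdiff_singleton {α : Type*} [DecidableEq α] {Z : Finset α} {x y : α}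
    (hx : x ∉ Z) (hy : y ∈ Z) : (insert x Z \ {y}).card = Z.card := by
  rw [card_sdiff_of_subset (by simp [hy]), card_insert_of_notMem hx]
  simp

theorem insert_sdiff_insert_of_notMem {α : Type*} [DecidableEq α] {Z : Finset α} {x : α}
    (hx : x ∉ Z) (O : Finset α) : insert x Z \ insert x O = Z \ O := by
  rw [insert_sdiff_insert, sdiff_insert, erase_eq_of_notMem]
  simp [hx]

/-- A complement of size `k` is either the `k` smallest elements, or the `k + 1` smallest with one
removed that is not the largest of them: `k` choices. -/
theorem card_almostUpper_sdiff {α : Type*} [LinearOrder α] (Z : Finset α) (k : ℕ) :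
    (∑ O ∈ almostUpper Z, if (Z \ O).card = k then 1 else 0) =
      (if k ≤ Z.card then 1 else 0) + k * (if k + 1 ≤ Z.card then 1 else 0) := by
  induction Z using Finset.induction_on_max generalizing k with
  | empty =>
    have : almostUpper (∅ : Finset α) = {∅} := by
      ext O
      simp only [mem_almostUpper, mem_singleton, subset_empty]
      exact ⟨fun h => h.1, fun h => ⟨h, by simp [h]⟩⟩
    rw [this]
    simp [eq_comm]
  | insert x Z hx ih =>
    have hxZ : x ∉ Z := fun h => lt_irrefl _ (hx x h)
    rw [sum_almostUpper_insert hx,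
      sum_congr (s₁ := Z) rfl fun y hy => by rw [card_insert_sdiff_singleton hxZ hy],
      sum_congr (s₁ := almostUpper Z) rfl fun O hO => by rw [insert_sdiff_insert_of_notMem hxZ], ih,
      sdiff_empty, card_insert_of_notMem hxZ, sum_const, smul_eq_mul]
    split_ifs <;> omega

/-- Omitting the maximum `x` leaves the empty set or one of the singletons other than `{x}`;
containing it reduces to the previous count on `Z` without `x`. -/
theorem sum_almostUpper_max {α : Type*} [LinearOrder α] {Z : Finset α} {x : α} (hxZ : x ∈ Z)
    (hx : ∀ y ∈ Z, y ≤ x) (k s t : ℕ) :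
    (∑ O ∈ almostUpper Z, if (Z \ O).card = k then (if x ∈ O then s else t) else 0) =
      ((if Z.card = k then 1 else 0) + k * (if Z.card = k + 1 then 1 else 0)) * t +
        ((if k + 1 ≤ Z.card then 1 else 0) + k * (if k + 2 ≤ Z.card then 1 else 0)) * s := by
  obtain ⟨Z, hxZ', rfl⟩ : ∃ Z', x ∉ Z' ∧ insert x Z' = Z :=
    ⟨Z.erase x, notMem_erase _ _, insert_erase hxZ⟩
  have hlt : ∀ y ∈ Z, y < x := fun y hy =>
    lt_of_le_of_ne (hx y (mem_insert_of_mem hy)) fun h => hxZ' (h ▸ hy)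
  rw [sum_almostUpper_insert hlt]
  have h1 : ∀ y ∈ Z, x ∉ ({y} : Finset α) := fun y hy h => hxZ' (mem_singleton.1 h ▸ hy)
  have h2 : (∑ O ∈ almostUpper Z, if (Z \ O).card = k then s else 0) =
      ((if k ≤ Z.card then 1 else 0) + k * (if k + 1 ≤ Z.card then 1 else 0)) * s := by
    rw [← card_almostUpper_sdiff, sum_mul]
    exact sum_congr rfl fun O _ => by split_ifs <;> simp
  rw [sum_congr (s₁ := Z) rfl fun y hy => by
      rw [card_insert_sdiff_singleton hxZ' hy, if_neg (h1 y hy)],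
    sum_congr (s₁ := almostUpper Z) rfl fun O hO => by
      rw [insert_sdiff_insert_of_notMem hxZ', if_pos (mem_insert_self _ _)], h2,
    sdiff_empty, card_insert_of_notMem hxZ', sum_const, smul_eq_mul]
  simp only [Nat.add_le_add_iff_right, notMem_empty, if_false, add_left_inj,
    show k + 2 = k + 1 + 1 from rfl]
  split_ifs <;> first | omega | (subst_vars; simp; try ring)

/-- Raise the entries of `e` by one, except for the zeros outside `O`, and prepend a zero. -/
def raiseCons {n : ℕ} (e : Fin n → ℕ) (O : Finset (Fin n)) : Fin (n + 1) → ℕ :=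
  Fin.cons 0 fun i => if e i = 0 ∧ i ∉ O then 0 else e i + 1

theorem raiseCons_zero {n : ℕ} (e : Fin n → ℕ) (O : Finset (Fin n)) : raiseCons e O 0 = 0 := rfl

theorem raiseCons_succ {n : ℕ} (e : Fin n → ℕ) (O : Finset (Fin n)) (i : Fin n) :
    raiseCons e O i.succ = if e i = 0 ∧ i ∉ O then 0 else e i + 1 := rfl

theorem raiseCons_mem_avoiding {n : ℕ} {e : Fin n → ℕ} {O : Finset (Fin n)}
    (he : e ∈ avoiding n pattern110) (hO : O ∈ almostUpper (zeroSet e)) :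
    raiseCons e O ∈ avoiding (n + 1) pattern110 := by
  rw [mem_avoiding_pattern110] at he ⊢
  simp only [mem_almostUpper, mem_zeroSet, subset_iff] at hO
  obtain ⟨hO, h⟩ := hO
  refine ⟨fun i => ?_, fun i j k hij hjk hE => ?_⟩
  · cases i using Fin.cases with
    | zero => simp [raiseCons_zero]
    | succ i =>
      have := he.1 i
      rw [raiseCons_succ, Fin.val_succ]
      split_ifs <;> omega
  · cases i using Fin.cases with
    | zero => rw [← hE, raiseCons_zero]; exact Nat.zero_le _
    | succ i =>
      obtain ⟨j, rfl⟩ := Fin.exists_succ_eq.2 (Fin.ne_zero_of_lt hij)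
      obtain ⟨k, rfl⟩ := Fin.exists_succ_eq.2 (Fin.ne_zero_of_lt hjk)
      rw [Fin.succ_lt_succ_iff] at hij hjk
      have h1 := he.2 i j k hij hjk
      have h2 := h i
      simp only [raiseCons_succ] at hE ⊢
      grind

/-- The inverse deletes the initial zero, lowers positive letters, and records where the ones were.
-/
theorem sum_avoiding_pattern110_succ (n : ℕ) (F : (Fin (n + 1) → ℕ) → ℕ) :
    ∑ e ∈ avoiding (n + 1) pattern110, F e =
      ∑ e ∈ avoiding n pattern110, ∑ O ∈ almostUpper (zeroSet e), F (raiseCons e O) := by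
  rw [sum_sigma']
  symm
  refine sum_bij' (fun x _ => raiseCons x.1 x.2)
    (fun e _ => ⟨fun i => e i.succ - 1, univ.filter fun i => e i.succ = 1⟩) ?_ ?_ ?_ ?_ ?_
  · rintro ⟨e, O⟩ h
    rw [mem_sigma] at h
    exact raiseCons_mem_avoiding h.1 h.2
  · intro e he
    simp only [mem_sigma, mem_almostUpper, subset_iff, mem_zeroSet, mem_filter, mem_univ, true_and]
    rw [mem_avoiding_pattern110] at he ⊢
    obtain ⟨h1, h2⟩ := he
    have h0 : e 0 = 0 := by simpa using h1 0
    refine ⟨⟨fun i => ?_, fun i j k hij hjk hE => ?_⟩, fun i hi => by omega,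
      fun i hi j hj k hk hij hjk => ?_⟩
    · have := h1 i.succ
      rw [Fin.val_succ] at this
      omega
    · have := h2 i.succ j.succ k.succ (by simpa) (by simpa)
      omega
    · have := h2 i.succ j.succ k.succ (by simpa) (by simpa)
      omega
  · rintro ⟨e, O⟩ h
    simp only [mem_sigma, mem_almostUpper, subset_iff, mem_zeroSet] at h
    have h1 : (fun i : Fin n => raiseCons e O i.succ - 1) = e := by
      funext i
      rw [raiseCons_succ]
      split_ifs <;> omega
    have h2 : (univ.filter fun i : Fin n => raiseCons e O i.succ = 1) = O := by
      ext i
      have := @h.2.1 i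
      rw [mem_filter, raiseCons_succ]
      grind
    simp only [h1, h2]
  · intro e he
    rw [mem_avoiding_pattern110] at he
    have h0 : e 0 = 0 := by simpa using he.1 0
    funext i
    cases i using Fin.cases with
    | zero => rw [raiseCons_zero, h0]
    | succ i =>
      simp only [raiseCons_succ, mem_filter, mem_univ, true_and]
      split_ifs <;> omega
  · intros
    rfl

theorem zero_raiseCons {n : ℕ} (e : Fin n → ℕ) (O : Finset (Fin n)) :
    zero (raiseCons e O) = (zeroSet e \ O).card + 1 := by
  rw [zero, Fin.card_filter_univ_succ]
  simp only [raiseCons_zero, if_true, raiseCons_succ]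
  congr 2
  ext i
  simp [mem_zeroSet]

theorem rmin_eq_card_pos {n : ℕ} {e : Fin n → ℕ} {x : Fin n} (hx : e x = 0)
    (hmax : ∀ i, e i = 0 → i ≤ x) :
    rmin e = (univ.filter fun i : Fin n => 0 < e i ∧ ∀ j, i < j → e i < e j).card + 1 := by
  rw [rmin, ← card_insert_of_notMem (a := x) (by simp [hx])]
  congr 1
  ext i
  simp only [mem_filter, mem_univ, true_and, mem_insert]
  constructor
  · intro h
    rcases Nat.eq_zero_or_pos (e i) with h0 | h0
    · rcases (hmax i h0).lt_or_eq with hlt | heq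
      · have := h x hlt
        omega
      · exact Or.inl heq
    · exact Or.inr ⟨h0, h⟩
  · rintro (rfl | h)
    · intro j hj
      rw [hx]
      by_contra hc
      exact absurd (hmax j (by omega)) (not_le.2 hj)
    · exact h.2

theorem exists_max_zero {n : ℕ} {e : Fin n → ℕ} (h : ∃ i, e i = 0) :
    ∃ x, e x = 0 ∧ ∀ i, e i = 0 → i ≤ x := by
  obtain ⟨i, hi⟩ := h
  have hne : (zeroSet e).Nonempty := ⟨i, mem_zeroSet.2 hi⟩
  exact ⟨(zeroSet e).max' hne, mem_zeroSet.1 (max'_mem _ _),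
    fun j hj => le_max' _ _ (mem_zeroSet.2 hj)⟩

/-- Only the last zero of a word is a minimum at level zero. If `x` is raised, it stays a minimum,
now with value 1, and the last remaining zero is an additional one; raised zeros before `x` are
never minima. -/
theorem rmin_raiseCons {n : ℕ} {e : Fin n → ℕ} {O : Finset (Fin n)} {x : Fin n} (hx : e x = 0)
    (hmax : ∀ i, e i = 0 → i ≤ x) :
    rmin (raiseCons e O) = rmin e + if x ∈ O then 1 else 0 := by
  obtain ⟨t, ht, htmax⟩ := exists_max_zero ⟨0, raiseCons_zero e O⟩
  rw [rmin_eq_card_pos hx hmax, rmin_eq_card_pos ht htmax, Fin.card_filter_univ_succ,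
    if_neg (by simp [raiseCons_zero])]
  have key : (univ.filter fun i : Fin n => 0 < raiseCons e O i.succ ∧
      ∀ j, i.succ < j → raiseCons e O i.succ < raiseCons e O j) =
      (univ.filter fun i : Fin n => 0 < e i ∧ ∀ j, i < j → e i < e j) ∪
        if x ∈ O then {x} else ∅ := by
    ext i
    have hi : (∀ j, i.succ < j → raiseCons e O i.succ < raiseCons e O j) ↔
        ∀ j : Fin n, i < j → raiseCons e O i.succ < raiseCons e O j.succ := by
      rw [Fin.forall_fin_succ]
      simp
    rw [mem_union, mem_filter, mem_filter, hi]
    simp only [mem_univ, true_and, raiseCons_succ]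
    rcases lt_trichotomy i x with h | h | h
    · have hne : i ≠ x := h.ne
      have hR : ¬ (0 < e i ∧ ∀ j, i < j → e i < e j) := fun hc => by
        have := hc.2 x h
        omega
      have hL : ¬ ((0 < if e i = 0 ∧ i ∉ O then 0 else e i + 1) ∧ ∀ j, i < j →
          (if e i = 0 ∧ i ∉ O then 0 else e i + 1) <
            if e j = 0 ∧ j ∉ O then 0 else e j + 1) := fun hc => by
        have := hc.2 x h
        grind
      have hS : i ∉ (if x ∈ O then {x} else ∅ : Finset (Fin n)) := by
        split_ifs <;> simp [hne]
      exact iff_of_false hL fun hc => hc.elim hR hS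
    · subst h
      have hpos : ∀ j, i < j → e j ≠ 0 := fun j hj h0 => absurd (hmax j h0) (not_le.2 hj)
      by_cases hO : i ∈ O
      · simp only [hO, hx, if_true, mem_singleton, or_true, iff_true]
        refine ⟨by simp, fun j hj => ?_⟩
        have := hpos j hj
        simp [this]
        omega
      · simp [hO, hx]
    · have hne : i ≠ x := h.ne'
      have hpos : ∀ j, i ≤ j → e j ≠ 0 := fun j hj h0 =>
        absurd (hmax j h0) (not_le.2 (h.trans_le hj))
      have hi0 := hpos i le_rfl
      have hR : i ∉ (if x ∈ O then {x} else ∅ : Finset (Fin n)) := by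
        split_ifs <;> simp [hne]
      simp only [hR, or_false, hi0, false_and, if_false]
      constructor
      · rintro ⟨-, h2⟩
        refine ⟨by omega, fun j hj => ?_⟩
        have := h2 j hj
        simp only [hpos j hj.le, false_and, if_false] at this
        omega
      · rintro ⟨-, h2⟩
        refine ⟨by omega, fun j hj => ?_⟩
        have := h2 j hj
        simp only [hpos j hj.le, false_and, if_false]
        omega
  rw [key, card_union_of_disjoint]
  · split_ifs <;> simp
  · split_ifs <;> simp [hx]

theorem weight_raiseCons {n : ℕ} {e : Fin (n + 1) → ℕ} {O : Finset (Fin (n + 1))}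
    {x : Fin (n + 1)} (hx : e x = 0) (hmax : ∀ i, e i = 0 → i ≤ x) (w : ℕ → ℕ → ℕ) :
    w (raiseCons e O (Fin.last (n + 1))) (rmin (raiseCons e O)) =
      if x ∈ O then lift w (e (Fin.last n)) (rmin e) else raise w (e (Fin.last n)) (rmin e) := by
  rw [rmin_raiseCons hx hmax, ← Fin.succ_last, raiseCons_succ]
  have hl : e (Fin.last n) = 0 → Fin.last n = x := fun h =>
    le_antisymm (hmax _ h) (Fin.le_last x)
  by_cases h0 : e (Fin.last n) = 0
  · rw [hl h0, hx]
    split_ifs <;> simp_all [lift, raise]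
  · split_ifs <;> simp_all [lift, raise]

/-- The total weight of the words of length `n + 1` with `k` zeros that avoid `p`. -/
noncomputable def weightSum {l : ℕ} (p : VincularPattern l) (n k : ℕ) (w : ℕ → ℕ → ℕ) : ℕ :=
  ∑ e ∈ avoiding (n + 1) p, if zero e = k then w (e (Fin.last n)) (rmin e) else 0

theorem weightSum_pattern110_zero_right (n : ℕ) (w : ℕ → ℕ → ℕ) :
    weightSum pattern110 n 0 w = 0 := by
  refine sum_eq_zero fun e he => if_neg ?_
  rw [mem_avoiding_pattern110] at he
  have h0 : e 0 = 0 := by simpa using he.1 0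
  exact card_ne_zero_of_mem (mem_filter.2 ⟨mem_univ 0, h0⟩)

theorem sum_range_ite_add_eq (n j c v : ℕ) (hj : j ≤ n) :
    (∑ i ∈ range (n + 1), if j = c + i then v else 0) = if c ≤ j then v else 0 := by
  by_cases h : c ≤ j
  · rw [if_pos h, sum_eq_single (j - c)]
    · rw [if_pos (by omega)]
    · intro i _ hi
      exact if_neg (by omega)
    · intro hi
      simp at hi
      omega
  · rw [if_neg h]
    exact sum_eq_zero fun i _ => if_neg (by omega)

theorem weightSum_pattern110_succ (n k : ℕ) (w : ℕ → ℕ → ℕ) :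
    weightSum pattern110 (n + 1) (k + 1) w =
      weightSum pattern110 n k (raise w) + k * weightSum pattern110 n (k + 1) (raise w) +
        ∑ i ∈ range (n + 1 + 1), (weightSum pattern110 n (k + 1 + i) (lift w) +
          k * weightSum pattern110 n (k + 2 + i) (lift w)) := by
  simp only [weightSum]
  rw [sum_avoiding_pattern110_succ, sum_add_distrib, ← mul_sum, sum_comm, sum_comm (s := range _)]
  simp only [mul_sum, ← sum_add_distrib]
  refine sum_congr rfl fun e he => ?_
  rw [mem_avoiding_pattern110] at he
  have h0 : e 0 = 0 := by simpa using he.1 0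
  obtain ⟨x, hx, hmax⟩ := exists_max_zero ⟨0, h0⟩
  have hz : zero e ≤ n + 1 := by
    rw [← card_zeroSet]
    exact (card_le_univ _).trans_eq (Fintype.card_fin _)
  simp only [zero_raiseCons, weight_raiseCons hx hmax, add_left_inj]
  rw [sum_almostUpper_max (mem_zeroSet.2 hx) (fun y hy => hmax y (mem_zeroSet.1 hy)), card_zeroSet,
    sum_add_distrib, ← mul_sum, sum_range_ite_add_eq _ _ _ _ hz, sum_range_ite_add_eq _ _ _ _ hz]
  split_ifs <;> simp <;> ring

/-! ### Words avoiding 120: appending a letter -/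

theorem contains_pattern120_iff {n : ℕ} (e : Fin (n + 1) → ℕ) :
    Contains e pattern120 ↔
      ∃ (i : Fin n) (k : Fin (n + 1)), i.succ < k ∧ e i.castSucc < e i.succ ∧
        e k < e i.castSucc := by
  constructor
  · rintro ⟨f, hf, h, h'⟩
    have h01 := (h 0 1).2 (by simp [pattern120])
    have h20 := (h 2 0).2 (by simp [pattern120])
    have hs : (f 1 : ℕ) = f 0 + 1 := h' 0 1 (by simp [pattern120]) rfl
    have hlt : (f 0 : ℕ) < n := by have := (f 1).isLt; omega
    have h1 : f 1 = (⟨f 0, hlt⟩ : Fin n).succ := Fin.ext hs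
    have h12 : f 1 < f 2 := hf (by decide)
    exact ⟨⟨f 0, hlt⟩, f 2, by rw [← h1]; exact h12, by rw [← h1]; exact h01, h20⟩
  · rintro ⟨i, k, hik, h1, h2⟩
    have hi : i.castSucc < i.succ := Fin.castSucc_lt_succ
    refine ⟨![i.castSucc, i.succ, k], ?_, ?_, ?_⟩
    · intro a b hab
      fin_cases a <;> fin_cases b <;> simp at hab ⊢ <;> first | assumption | exact hi.trans hik
    · intro a b
      fin_cases a <;> fin_cases b <;> simp [pattern120] <;> omega
    · intro a b ha hab
      have ha' : a = 0 := by simpa [pattern120] using ha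
      subst ha'
      have hb : b = 1 := Fin.ext (by simpa using hab)
      subst hb
      simp

theorem mem_avoiding_pattern120 {n : ℕ} {e : Fin (n + 1) → ℕ} :
    e ∈ avoiding (n + 1) pattern120 ↔
      (∀ i : Fin (n + 1), e i ≤ i) ∧
        ∀ (i : Fin n) (k : Fin (n + 1)), i.succ < k → e i.castSucc < e i.succ →
          e i.castSucc ≤ e k := by
  simp only [avoiding, inversionSequences, mem_filter, Fintype.mem_piFinset, mem_range,
    Nat.lt_succ_iff, contains_pattern120_iff]
  push Not
  rfl

/-- The largest ascent bottom, or `0` if there is no ascent. -/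
def maxBottom {n : ℕ} (e : Fin (n + 1) → ℕ) : ℕ :=
  univ.sup fun i : Fin n => if e i.castSucc < e i.succ then e i.castSucc else 0

/-- The number of right-to-left minima whose entry is less than `m`. -/
def rminBelow {n : ℕ} (e : Fin n → ℕ) (m : ℕ) : ℕ :=
  (univ.filter fun i : Fin n => (∀ j : Fin n, i < j → e i < e j) ∧ e i < m).card

/-- Append the letter `y`. -/
def append {n : ℕ} (e : Fin n → ℕ) (y : ℕ) : Fin (n + 1) → ℕ :=
  Fin.snoc (α := fun _ => ℕ) e y

@[simp] theorem append_castSucc {n : ℕ} (e : Fin n → ℕ) (y : ℕ) (i : Fin n) :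
    append e y i.castSucc = e i := by
  simp [append]

@[simp] theorem append_last {n : ℕ} (e : Fin n → ℕ) (y : ℕ) : append e y (Fin.last n) = y := by
  simp [append]

theorem maxBottom_le_iff {n : ℕ} {e : Fin (n + 1) → ℕ} {m : ℕ} :
    maxBottom e ≤ m ↔ ∀ i : Fin n, e i.castSucc < e i.succ → e i.castSucc ≤ m := by
  simp only [maxBottom, Finset.sup_le_iff, mem_univ, true_implies]
  refine forall_congr' fun i => ?_
  split_ifs with h <;> simp [h]

theorem ascentBottom_le {n : ℕ} {e : Fin (n + 1) → ℕ} (he : e ∈ avoiding (n + 1) pattern120)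
    {i : Fin n} {k : Fin (n + 1)} (hi : e i.castSucc < e i.succ) (hk : i.castSucc < k) :
    e i.castSucc ≤ e k := by
  rcases (Fin.castSucc_lt_iff_succ_le.1 hk).eq_or_lt with h | h
  · rw [← h]
    exact hi.le
  · exact (mem_avoiding_pattern120.1 he).2 i k h hi

theorem maxBottom_le_last {n : ℕ} {e : Fin (n + 1) → ℕ}
    (he : e ∈ avoiding (n + 1) pattern120) : maxBottom e ≤ e (Fin.last n) :=
  maxBottom_le_iff.2 fun i hi => ascentBottom_le he hi (Fin.castSucc_lt_last i)

/-- The new letter can only play the role of the 0 in the pattern, so it only has to stay above all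
ascent bottoms. -/
theorem append_mem_avoiding_iff {n : ℕ} {e : Fin (n + 1) → ℕ} {y : ℕ} :
    append e y ∈ avoiding (n + 2) pattern120 ↔
      e ∈ avoiding (n + 1) pattern120 ∧ maxBottom e ≤ y ∧ y ≤ n + 1 := by
  rw [mem_avoiding_pattern120, mem_avoiding_pattern120, maxBottom_le_iff]
  constructor
  · rintro ⟨h1, h2⟩
    refine ⟨⟨fun i => ?_, fun i k hik hi => ?_⟩, fun i hi => ?_, ?_⟩
    · simpa using h1 i.castSucc
    · have := h2 i.castSucc k.castSucc
      simp only [Fin.succ_castSucc, append_castSucc, Fin.castSucc_lt_castSucc_iff] at this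
      exact this hik hi
    · have := h2 i.castSucc (Fin.last _)
      simp only [Fin.succ_castSucc, append_castSucc, append_last] at this
      exact this (Fin.castSucc_lt_last _) hi
    · simpa using h1 (Fin.last _)
  · rintro ⟨⟨h1, h2⟩, h3, h4⟩
    refine ⟨fun i => ?_, fun i k hik hi => ?_⟩
    · cases i using Fin.lastCases with
      | last => simpa using h4
      | cast i => simpa using h1 i
    · cases i using Fin.lastCases with
      | last => exact absurd hik (by simp [Fin.le_last])
      | cast i =>
        rw [Fin.succ_castSucc] at hik hi
        rw [append_castSucc, append_castSucc] at hi
        rw [append_castSucc]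
        cases k using Fin.lastCases with
        | last => simpa using h3 i hi
        | cast k =>
          rw [append_castSucc]
          exact h2 i k (Fin.castSucc_lt_castSucc_iff.1 hik) hi

theorem sum_avoiding_pattern120_succ (n : ℕ) (F : (Fin (n + 2) → ℕ) → ℕ) :
    ∑ e ∈ avoiding (n + 2) pattern120, F e =
      ∑ e ∈ avoiding (n + 1) pattern120, ∑ y ∈ Icc (maxBottom e) (n + 1), F (append e y) := by
  rw [sum_sigma']
  symm
  have hinv : ∀ e : Fin (n + 2) → ℕ,
      append (fun i : Fin (n + 1) => e i.castSucc) (e (Fin.last _)) = e := by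
    intro e
    funext i
    cases i using Fin.lastCases <;> simp
  refine sum_bij' (fun x _ => append x.1 x.2)
    (fun e _ => ⟨fun i => e i.castSucc, e (Fin.last _)⟩) ?_ ?_ ?_ ?_ ?_
  · rintro ⟨e, y⟩ h
    simp only [mem_sigma, mem_Icc] at h
    exact append_mem_avoiding_iff.2 h
  · intro e he
    rw [← hinv e, append_mem_avoiding_iff] at he
    simpa only [mem_sigma, mem_Icc] using he
  · rintro ⟨e, y⟩ _
    simp
  · intro e _
    exact hinv e
  · intros
    rfl

theorem maxBottom_append {n : ℕ} {e : Fin (n + 1) → ℕ} (he : e ∈ avoiding (n + 1) pattern120)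
    (y : ℕ) :
    maxBottom (append e y) = if y ≤ e (Fin.last n) then maxBottom e else e (Fin.last n) := by
  have h : maxBottom (append e y) =
      max (if e (Fin.last n) < y then e (Fin.last n) else 0) (maxBottom e) := by
    rw [maxBottom, Fin.univ_castSuccEmb, sup_cons, sup_map]
    simp only [append_castSucc, Fin.succ_last, append_last, maxBottom]
    congr 1
    refine sup_congr rfl fun i _ => ?_
    simp only [Function.comp_apply, Fin.coe_castSuccEmb, Fin.succ_castSucc, append_castSucc]
  have := maxBottom_le_last he
  rw [h]
  split_ifs <;> omega

theorem zero_append {n : ℕ} (e : Fin n → ℕ) (y : ℕ) :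
    zero (append e y) = if y = 0 then zero e + 1 else zero e := by
  simp only [zero, card_filter, Fin.sum_univ_castSucc, append_castSucc, append_last]
  split_ifs <;> simp

theorem rminBelow_append {n : ℕ} (e : Fin n → ℕ) {y m : ℕ} (h : m ≤ y) :
    rminBelow (append e y) m = rminBelow e m := by
  simp only [rminBelow, card_filter, Fin.sum_univ_castSucc, append_last,
    Fin.forall_fin_succ', append_castSucc, Fin.castSucc_lt_castSucc_iff, Fin.castSucc_lt_last,
    true_implies]
  rw [if_neg (by omega), add_zero]
  refine sum_congr rfl fun i _ => if_congr ?_ rfl rfl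
  constructor
  · rintro ⟨⟨h1, -⟩, h2⟩
    exact ⟨h1, h2⟩
  · rintro ⟨h1, h2⟩
    exact ⟨⟨h1, by omega⟩, h2⟩

theorem rminBelow_last {n : ℕ} (e : Fin (n + 1) → ℕ) :
    rminBelow e (e (Fin.last n)) + 1 = rmin e := by
  rw [rminBelow, rmin, ← card_insert_of_notMem (a := Fin.last n) (by simp)]
  congr 1
  ext i
  simp only [mem_insert, mem_filter, mem_univ, true_and]
  constructor
  · rintro (rfl | h)
    · exact fun j hj => absurd hj (Fin.le_last j).not_gt
    · exact h.1
  · intro h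
    rcases (Fin.le_last i).eq_or_lt with hi | hi
    · exact Or.inl hi
    · exact Or.inr ⟨h, h _ hi⟩

/-- The witness is the last occurrence of the largest ascent bottom: no letter after that bottom is
smaller. Without a positive bottom, the initial zero starts the argument. -/
theorem exists_maxBottom {n : ℕ} {e : Fin (n + 1) → ℕ} (he : e ∈ avoiding (n + 1) pattern120) :
    ∃ t, e t = maxBottom e ∧ ∀ j, t < j → e t < e j := by
  have h0 : e 0 = 0 := by simpa using (mem_avoiding_pattern120.1 he).1 0
  have hex : ∃ i, e i = maxBottom e ∧ ∀ j, i < j → maxBottom e ≤ e j := by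
    rcases Nat.eq_zero_or_pos (maxBottom e) with h | h
    · exact ⟨0, by omega, fun j _ => by omega⟩
    · have hne : (univ : Finset (Fin n)).Nonempty := by
        rw [nonempty_iff_ne_empty]
        intro hc
        rw [maxBottom, hc, sup_empty] at h
        exact lt_irrefl _ h
      obtain ⟨i, -, hi⟩ := exists_mem_eq_sup univ hne
        fun i : Fin n => if e i.castSucc < e i.succ then e i.castSucc else 0
      change maxBottom e = _ at hi
      by_cases ha : e i.castSucc < e i.succ
      · rw [if_pos ha] at hi
        exact ⟨i.castSucc, hi.symm, fun j hj => hi ▸ ascentBottom_le he ha hj⟩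
      · rw [if_neg ha] at hi
        omega
  obtain ⟨i, hi, hle⟩ := hex
  have hne : (univ.filter fun j => e j = maxBottom e).Nonempty :=
    ⟨i, mem_filter.2 ⟨mem_univ _, hi⟩⟩
  set t := (univ.filter fun j => e j = maxBottom e).max' hne with ht
  have hmem : e t = maxBottom e := (mem_filter.1 (max'_mem _ hne)).2
  refine ⟨t, hmem, fun j hj => ?_⟩
  have hit : i ≤ t := le_max' (univ.filter fun j => e j = maxBottom e) i (mem_filter.2 ⟨mem_univ _, hi⟩)
  have h1 := hle j (hit.trans_lt hj)
  refine lt_of_le_of_ne (hmem ▸ h1) fun hc => absurd hj (not_lt.2 ?_)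
  exact le_max' (univ.filter fun j => e j = maxBottom e) j (mem_filter.2 ⟨mem_univ _, by omega⟩)

/-- A right-to-left minimum other than the last letter is an ascent bottom. So those not below
`maxBottom e` are the last letter and the last occurrence of `maxBottom e`, which may coincide. -/
theorem rmin_eq_rminBelow_maxBottom {n : ℕ} {e : Fin (n + 1) → ℕ}
    (he : e ∈ avoiding (n + 1) pattern120) :
    rmin e = rminBelow e (maxBottom e) + if maxBottom e < e (Fin.last n) then 2 else 1 := by
  have hle := maxBottom_le_last he
  rw [← rminBelow_last]
  split_ifs with hlt
  · obtain ⟨t, ht, htm⟩ := exists_maxBottom he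
    rw [show 2 = 1 + 1 from rfl, ← add_assoc, Nat.add_right_cancel_iff, rminBelow, rminBelow,
      ← card_insert_of_notMem (a := t) (by simp [ht])]
    congr 1
    ext i
    simp only [mem_insert, mem_filter, mem_univ, true_and]
    constructor
    · rintro ⟨h1, h2⟩
      cases i using Fin.lastCases with
      | last => exact absurd h2 (lt_irrefl _)
      | cast i =>
        have ha : e i.castSucc < e i.succ := h1 _ Fin.castSucc_lt_succ
        have hb : e i.castSucc ≤ maxBottom e := maxBottom_le_iff.1 le_rfl i ha
        rcases hb.lt_or_eq with hb | hb
        · exact Or.inr ⟨h1, hb⟩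
        · left
          by_contra hne
          rcases lt_or_gt_of_ne hne with h | h
          · have := h1 _ h
            omega
          · have := htm _ h
            omega
    · rintro (rfl | ⟨h1, h2⟩)
      · exact ⟨htm, by omega⟩
      · exact ⟨h1, by omega⟩
  · rw [show maxBottom e = e (Fin.last n) by omega]

theorem rminBelow_maxBottom_append {n : ℕ} {e : Fin (n + 1) → ℕ}
    (he : e ∈ avoiding (n + 1) pattern120) {y : ℕ} (hy : maxBottom e ≤ y) :
    rminBelow (append e y) (maxBottom (append e y)) =
      if y ≤ e (Fin.last n) then rminBelow e (maxBottom e)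
      else if maxBottom e < e (Fin.last n) then rminBelow e (maxBottom e) + 1
      else rminBelow e (maxBottom e) := by
  have h1 := rminBelow_last e
  have h2 := rmin_eq_rminBelow_maxBottom he
  rw [maxBottom_append he]
  split_ifs at h2 ⊢ <;> rw [rminBelow_append _ (by omega)] <;> omega

/-! ### Matching words with the generating tree -/

/-- The total weight of the extensions by `m` letters of a word of length `N` avoiding
`pattern120`, with largest ascent bottom `M`, last letter `l`, `r` right-to-left minima below `M`
and `z` zeros. -/
def stateExtensions (m N M l r z : ℕ) (W : ℕ → ℕ → ℕ → ℕ) : ℕ :=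
  extensions m (N - M) (l - M) (if M = 0 then z else 0)
    (if M = 0 then W else fun _ a c => W z (a + M) (c + r))

theorem sum_Icc_split {M l N : ℕ} (h1 : M ≤ l) (h2 : l ≤ N) (f : ℕ → ℕ) :
    ∑ y ∈ Icc M N, f y =
      f M + ∑ t ∈ range (l - M), f (M + t + 1) + ∑ t ∈ range (N - l), f (l + t + 1) := by
  obtain ⟨a, rfl⟩ := Nat.exists_eq_add_of_le h1
  obtain ⟨b, rfl⟩ := Nat.exists_eq_add_of_le h2
  have h : Icc M (M + a + b) = Ico M (M + a + b + 1) := rfl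
  rw [h, sum_Ico_eq_sum_range, show M + a + b + 1 - M = a + b + 1 by omega, sum_range_succ',
    sum_range_add]
  simp only [Nat.add_sub_cancel_left, add_zero]
  simp only [add_assoc]
  ring

/-- The letters `M`, those in `(M, l]` and those in `(l, N]` are the three branches of `extensions`;
for `l = M` the middle one is empty and the bottom does not move. -/
theorem stateExtensions_succ (m : ℕ) {N M l r : ℕ} (z : ℕ) (W : ℕ → ℕ → ℕ → ℕ) (h1 : M ≤ l)
    (h2 : l ≤ N) (h3 : M = 0 → r = 0) :
    stateExtensions (m + 1) N M l r z W =
      ∑ y ∈ Icc M N, stateExtensions m (N + 1) (if y ≤ l then M else l) y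
        (if y ≤ l then r else if M < l then r + 1 else r) (if y = 0 then z + 1 else z) W := by
  rw [sum_Icc_split h1 h2]
  have e2 : ∀ t ∈ range (l - M), stateExtensions m (N + 1) (if M + t + 1 ≤ l then M else l)
      (M + t + 1) (if M + t + 1 ≤ l then r else if M < l then r + 1 else r)
      (if M + t + 1 = 0 then z + 1 else z) W =
      stateExtensions m (N + 1) M (M + t + 1) r z W := fun t ht => by
    rw [mem_range] at ht
    rw [if_pos (by omega), if_pos (by omega), if_neg (by omega)]
  have e3 : ∀ t ∈ range (N - l), stateExtensions m (N + 1) (if l + t + 1 ≤ l then M else l)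
      (l + t + 1) (if l + t + 1 ≤ l then r else if M < l then r + 1 else r)
      (if l + t + 1 = 0 then z + 1 else z) W =
      stateExtensions m (N + 1) l (l + t + 1) (if M < l then r + 1 else r) z W := fun t _ => by
    simp only [show ¬ l + t + 1 ≤ l by omega, show ¬ l + t + 1 = 0 by omega, if_false]
  have e1 : stateExtensions m (N + 1) M M r (if M = 0 then z + 1 else z) W =
      extensions m (N - M + 1) 0 ((if M = 0 then z else 0) + 1)
        (if M = 0 then W else fun _ a c => W z (a + M) (c + r)) := by
    unfold stateExtensions
    rw [Nat.sub_self, show N + 1 - M = N - M + 1 by omega]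
    split_ifs
    · rfl
    · exact extensions_const _ _ _ _ _ _
  rw [sum_congr rfl e2, sum_congr rfl e3, if_pos h1, if_pos h1, e1]
  obtain ⟨d, rfl⟩ := Nat.exists_eq_add_of_le h1
  cases d with
  | zero =>
    simp only [stateExtensions, add_zero, Nat.sub_self, range_zero, sum_empty, lt_irrefl, if_false,
      extensions]
    congr 1
    refine sum_congr rfl fun t _ => ?_
    rw [show N + 1 - M = N - M + 1 by omega, show M + t + 1 - M = t + 1 by omega]
  | succ d =>
    simp only [stateExtensions, Nat.add_sub_cancel_left, extensions]
    rw [show N - M - d - 1 = N - (M + (d + 1)) by omega]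
    congr 1
    · congr 1
      refine sum_congr rfl fun t _ => ?_
      rw [show N + 1 - M = N - M + 1 by omega, show M + t + 1 - M = t + 1 by omega]
    · refine sum_congr rfl fun t _ => ?_
      simp only [show ¬ M + (d + 1) = 0 by omega, show M < M + (d + 1) by omega, if_true, if_false]
      rw [show N + 1 - (M + (d + 1)) = N - M - d by omega,
        show M + (d + 1) + t + 1 - (M + (d + 1)) = t + 1 by omega]
      congr 1
      funext _ a c
      -- When the bottom leaves 0, the number of zeros is frozen at `z` in the weight; otherwise it
      -- was frozen already.
      by_cases hM : M = 0
      · subst hM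
        simp [shift, h3 rfl]
      · simp only [shift, hM, if_false]
        congr 1 <;> omega

/-- The total weight of the words of length `n + 1 + m` avoiding `pattern120`, sorted by their
prefixes of length `n + 1`. -/
noncomputable def prefixSum (m n : ℕ) (W : ℕ → ℕ → ℕ → ℕ) : ℕ :=
  ∑ e ∈ avoiding (n + 1) pattern120, stateExtensions m (n + 1) (maxBottom e) (e (Fin.last n))
    (rminBelow e (maxBottom e)) (zero e) W

theorem rminBelow_zero {n : ℕ} (e : Fin n → ℕ) : rminBelow e 0 = 0 := by
  simp [rminBelow]

/-- Moving the cut one letter to the right transports the sum from the root of the tree to the full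
words. -/
theorem prefixSum_succ (m n : ℕ) (W : ℕ → ℕ → ℕ → ℕ) :
    prefixSum (m + 1) n W = prefixSum m (n + 1) W := by
  rw [prefixSum, prefixSum, sum_avoiding_pattern120_succ]
  refine sum_congr rfl fun e he => ?_
  have hl : e (Fin.last n) ≤ n + 1 := by
    have := (mem_avoiding_pattern120.1 he).1 (Fin.last n)
    rw [Fin.val_last] at this
    omega
  rw [stateExtensions_succ m _ _ (maxBottom_le_last he) hl fun h => by rw [h, rminBelow_zero]]
  refine sum_congr rfl fun y hy => ?_
  rw [rminBelow_maxBottom_append he (mem_Icc.1 hy).1, maxBottom_append he, append_last,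
    zero_append]

theorem prefixSum_zero_left (n : ℕ) (W : ℕ → ℕ → ℕ → ℕ) :
    prefixSum 0 n W =
      ∑ e ∈ avoiding (n + 1) pattern120, W (zero e) (e (Fin.last n)) (rmin e) := by
  refine sum_congr rfl fun e he => ?_
  have h1 := maxBottom_le_last he
  rw [rmin_eq_rminBelow_maxBottom he]
  simp only [stateExtensions, extensions]
  by_cases h : maxBottom e = 0
  · simp only [h, if_true, rminBelow_zero, Nat.sub_zero, zero_add]
    congr 1
    split_ifs <;> omega
  · simp only [h, if_false]
    congr 1
    · omega
    · split_ifs <;> omega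

theorem sum_avoiding_one {l : ℕ} {p : VincularPattern l} (hp : 1 < l) (F : (Fin 1 → ℕ) → ℕ) :
    ∑ e ∈ avoiding 1 p, F e = F fun _ => 0 := by
  have : avoiding 1 p = {fun _ => 0} := by
    ext e
    simp only [avoiding, inversionSequences, mem_filter, Fintype.mem_piFinset, mem_range,
      mem_singleton]
    constructor
    · rintro ⟨h, -⟩
      funext i
      have := h i
      omega
    · rintro rfl
      refine ⟨fun i => Nat.succ_pos _, ?_⟩
      rintro ⟨f, hf, -⟩
      have := hf (show (⟨0, by omega⟩ : Fin l) < ⟨1, hp⟩ from Nat.zero_lt_one)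
      omega
  rw [this, sum_singleton]

theorem prefixSum_zero_right (m : ℕ) (W : ℕ → ℕ → ℕ → ℕ) :
    prefixSum m 0 W = extensions m 1 0 1 W := by
  rw [prefixSum, sum_avoiding_one (by omega)]
  simp [stateExtensions, maxBottom, zero]

theorem prefixSum_eq (m n : ℕ) (W : ℕ → ℕ → ℕ → ℕ) :
    prefixSum m n W = extensions (m + n) 1 0 1 W := by
  induction n generalizing m with
  | zero => exact prefixSum_zero_right m W
  | succ n ih => rw [← prefixSum_succ, ih, Nat.add_right_comm, add_assoc]

/-! ### Comparing the two recurrences -/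

theorem weightSum_pattern120 (n k : ℕ) (w : ℕ → ℕ → ℕ) :
    weightSum pattern120 n k w = zeroSum (n + 1) k w := by
  have h := prefixSum_eq 0 n fun z a c => if z = k then w a c else 0
  rwa [Nat.zero_add, prefixSum_zero_left, extensions_one_eq_zeroSum] at h

theorem weightSum_zero_left {l l' : ℕ} {p : VincularPattern l} {p' : VincularPattern l'}
    (hp : 1 < l) (hp' : 1 < l') (k : ℕ) (w : ℕ → ℕ → ℕ) :
    weightSum p 0 k w = weightSum p' 0 k w := by
  rw [weightSum, weightSum, sum_avoiding_one hp, sum_avoiding_one hp']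

theorem weightSum_pattern120_eq_pattern110 (n k : ℕ) (w : ℕ → ℕ → ℕ) :
    weightSum pattern120 n k w = weightSum pattern110 n k w := by
  induction n generalizing k w with
  | zero => exact weightSum_zero_left (by omega) (by omega) k w
  | succ n ih =>
    cases k with
    | zero => rw [weightSum_pattern120, weightSum_pattern110_zero_right, zeroSum]
    | succ k =>
      rw [weightSum_pattern120, zeroSum_succ (by omega), weightSum_pattern110_succ]
      simp only [← weightSum_pattern120, ih]

theorem card_filter_eq_weightSum {l : ℕ} (p : VincularPattern l) (n a b c : ℕ)
    (hn : 1 ≤ n + 1) :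
    ((avoiding (n + 1) p).filter fun e => last hn e = a ∧ zero e = b ∧ rmin e = c).card =
      weightSum p n b fun a' c' => if a' = a ∧ c' = c then 1 else 0 := by
  rw [card_filter, weightSum]
  refine sum_congr rfl fun e _ => ?_
  have : last hn e = e (Fin.last n) := rfl
  rw [this]
  split_ifs <;> tauto

end InvSeq

theorem mainTheorem4 (n : ℕ) (hn : 1 ≤ n) (a b c : ℕ) :
    ((InvSeq.avoiding n InvSeq.pattern120).filter fun e =>
        InvSeq.last hn e = a ∧ InvSeq.zero e = b ∧ InvSeq.rmin e = c).card =
      ((InvSeq.avoiding n InvSeq.pattern110).filter fun e =>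
        InvSeq.last hn e = a ∧ InvSeq.zero e = b ∧ InvSeq.rmin e = c).card := by
  obtain ⟨n, rfl⟩ := Nat.exists_eq_add_of_le' hn
  rw [InvSeq.card_filter_eq_weightSum, InvSeq.card_filter_eq_weightSum,
    InvSeq.weightSum_pattern120_eq_pattern110]
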